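/- Let $k$ be a unital commutative ring, $X$ a set and $\Omega$ a semigroup. Operations on $k$-modules are bilinear. **Rota–Baxter family algebras.** A Rota–Baxter family algebra of weight $\lambda\in k$ is a unital associative $k$-algebra $R$ with linear maps $(P_\omega)_{\omega\in\Omega}$ such that $P_\alpha(a)P_\beta(b)=P_{\alpha\beta}\big(P_\alpha(a)b+aP_\beta(b)+\lambda ab\big)$. **Tridendriform family algebras.** A tridendriform family algebra is a $k$-module with operations $(\prec_\omega,\succ_\omega)_{\omega\in\Omega}$ and $\cdot$ such that $(x\prec_\alpha y)\prec_\beta z=x\prec_{\alpha\beta}(y\prec_\beta z+y\succ_\alpha z+y\cdot z)$, $(x\succ_\alpha y)\prec_\beta z=x\succ_\alpha(y\prec_\beta z)$, $(x\prec_\beta y+x\succ_\alpha y+x\cdot y)\succ_{\alpha\beta}z=x\succ_\alpha(y\succ_\beta z)$, $(x\succ_\alpha y)\cdot z=x\succ_\alpha(y\cdot z)$, $(x\prec_\alpha y)\cdot z=x\cdot(y\succ_\alpha z)$, $(x\cdot y)\prec_\alpha z=x\cdot(y\prec_\alpha z)$, $(x\cdot y)\cdot z=x\cdot(y\cdot z)$.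 **Trees.** Let $\mathcal T$ be the set of planar rooted trees with at least one vertex, whose angles (pairs of adjacent incoming edges of a vertex) are decorated by $X$ and whose internal edges are typed by $\Omega$. The leaves and the root are edges without type. Let $\bullet$ be the tree with one vertex and one leaf. For $x\in X$ let $Y_x$ be the tree with one vertex, two leaves and angle $x$. Let $B^+_\omega(T)$ be obtained by grafting $T$ on a new root by an internal edge of type $\omega$; extend $B^+_\omega$ linearly to $k\mathcal T$. **The product $\diamond$.** For $\lambda\in k$ let $\diamond=\diamond_\lambda$ be the bilinear product on $k\mathcal T$ defined recursively as follows. In $T\diamond T'$ the roots are identified, and the last incoming edge of the root of $T$ and the first incoming edge of the root of $T'$ are merged. If one of them is a leaf, the other one is kept. If they are internal edges of types $\alpha,\beta$ carrying trees $S,S'$, they become one edge of type $\alpha\beta$ carrying $B^+_\alpha(S)\diamond S'+S\diamond B^+_\beta(S')+\lambda\, S\diamond S'$ (expanded linearly). **Schröder trees.** Let $\mathcal S\subset\mathcal T$ be the set of Schröder trees (every vertex has at least two incoming edges). On $\mathrm{DT}(X,\Omega):=k\mathcal S$ define bilinear operations recursively. For $T,U\in\mathcal S$: * $T\prec_\omega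 U$ is obtained by replacing the last incoming edge of the root of $T$: a leaf becomes an edge of type $\omega$ carrying $U$, and an edge of type $\alpha$ carrying $S$ becomes an edge of type $\alpha\omega$ carrying $S\succ_\alpha U+S\prec_\omega U+S\cdot U$. * $T\succ_\omega U$ is obtained by replacing the first incoming edge of the root of $U$: a leaf becomes an edge of type $\omega$ carrying $T$, and an edge of type $\beta$ carrying $V$ becomes an edge of type $\omega\beta$ carrying $T\succ_\omega V+T\prec_\beta V+T\cdot V$. * $T\cdot U$ is obtained by identifying the roots and merging the last incoming edge of $T$ with the first incoming edge of $U$: if one is a leaf the other is kept, and edges of types $\alpha,\beta$ carrying $S,V$ become an edge of type $\alpha\beta$ carrying $S\succ_\alpha V+S\prec_\beta V+S\cdot V$. **Theorem.** 1. $(k\mathcal T,\diamond_1,\bullet,(B^+_\omega)_{\omega})$ with $x\mapsto Y_x$ is the free Rota–Baxter family algebra of weight $1$ on $X$, and $(\mathrm{DT}(X,\Omega),(\prec_\omega,\succ_\omega)_\omega,\cdot)$ with $x\mapsto Y_x$ is the free tridendriform family algebra on $X$. The operations $T\prec'_\omega U=T\diamond_1 B^+_\omega(U)$, $T\succ'_\omega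 U=B^+_\omega(T)\diamond_1 U$, $T\cdot' U=T\diamond_1 U$ make $k\mathcal T$ a tridendriform family algebra. The span $k\mathcal S$ of the Schröder trees is closed under them, and the canonical inclusion $j:\mathrm{DT}(X,\Omega)\to k\mathcal T$ is an injective morphism of tridendriform family algebras with image $k\mathcal S$ and $j(Y_x)=Y_x$. So the free tridendriform family algebra on $X$ is a tridendriform family subalgebra of the free Rota–Baxter family algebra of weight $1$ on $X$. 2. Let $\lambda\in k$ be invertible (any $\lambda\ne0$ if $k$ is a field). Then $(k\mathcal T,\diamond_\lambda,\bullet,(B^+_\omega)_\omega)$ with $x\mapsto Y_x$ is the free Rota–Baxter family algebra of weight $\lambda$ on $X$. The operations $T\prec'_\omega U=T\diamond_\lambda B^+_\omega(U)$, $T\succ'_\omega U=B^+_\omega(T)\diamond_\lambda U$, $T\cdot'U=\lambda\,T\diamond_\lambda U$ make $k\mathcal T$ a tridendriform family algebra, and $k\mathcal S$ is closed under them. The linear map $j_\lambda:\mathrm{DT}(X,\Omega)\to k\mathcal T$, $j_\lambda(T)=\lambda^{-|V(T)|}\,T$, where $|V(T)|$ is the number of vertices of $T\in\mathcal S$, is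 an injective morphism of tridendriform family algebras with image $k\mathcal S$, and $j_\lambda(Y_x)=\lambda^{-1}j(Y_x)$ for all $x\in X$. -/

import Mathlib

universe w

/-! # Abstract family algebras

All operations on a `k`-module are bilinear and are given as `k`-bilinear maps. -/

section Abstract

variable {k : Type*} [CommRing k] {Ω : Type*} [Semigroup Ω]

/-- A Rota-Baxter family algebra of weight `l`: a unital associative `k`-algebra (product `mul`,
unit `one`) with linear operators `P ω`, `ω ∈ Ω`, satisfying the Rota-Baxter family identity. -/
structure IsRotaBaxterFamilyAlgebra {A : Type*} [AddCommGroup A] [Module k A]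
    (l : k) (mul : A →ₗ[k] A →ₗ[k] A) (one : A) (P : Ω → A →ₗ[k] A) : Prop where
  mul_assoc : ∀ a b c, mul (mul a b) c = mul a (mul b c)
  one_mul : ∀ a, mul one a = a
  mul_one : ∀ a, mul a one = a
  rotaBaxter : ∀ (α β : Ω) (a b : A),
    mul (P α a) (P β b) = P (α * β) (mul (P α a) b + mul a (P β b) + l • mul a b)

/-- Morphisms of Rota-Baxter family algebras: unital algebra morphisms commuting with all the
operators. -/
structure IsRotaBaxterFamilyHom {A B : Type*} [AddCommGroup A] [Module k A]
    [AddCommGroup B] [Module k B]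
    (mulA : A →ₗ[k] A →ₗ[k] A) (oneA : A) (PA : Ω → A →ₗ[k] A)
    (mulB : B →ₗ[k] B →ₗ[k] B) (oneB : B) (PB : Ω → B →ₗ[k] B) (F : A →ₗ[k] B) : Prop where
  map_mul : ∀ a b, F (mulA a b) = mulB (F a) (F b)
  map_one : F oneA = oneB
  map_op : ∀ ω a, F (PA ω a) = PB ω (F a)

/-- `(A, mul, one, P)` together with `i : X → A` is the free Rota-Baxter family algebra of
weight `l` on `X`. -/
def IsFreeRotaBaxterFamilyAlgebra {X A : Type*} [AddCommGroup A] [Module k A]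
    (l : k) (mul : A →ₗ[k] A →ₗ[k] A) (one : A) (P : Ω → A →ₗ[k] A) (i : X → A) : Prop :=
  IsRotaBaxterFamilyAlgebra l mul one P ∧
  ∀ (R : Type w) [AddCommGroup R] [Module k R]
    (mulR : R →ₗ[k] R →ₗ[k] R) (oneR : R) (PR : Ω → R →ₗ[k] R),
    IsRotaBaxterFamilyAlgebra l mulR oneR PR →
    ∀ f : X → R, ∃! F : A →ₗ[k] R,
      IsRotaBaxterFamilyHom mul one P mulR oneR PR F ∧ ∀ x, F (i x) = f x

/-- A tridendriform family algebra: a `k`-module with operations `≺_ω`, `≻_ω` (`ω ∈ Ω`), `·`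
satisfying the seven axioms. -/
structure IsTridendriformFamilyAlgebra {D : Type*} [AddCommGroup D] [Module k D]
    (prec succ : Ω → D →ₗ[k] D →ₗ[k] D) (dot : D →ₗ[k] D →ₗ[k] D) : Prop where
  prec_prec : ∀ (α β : Ω) (x y z : D),
    prec β (prec α x y) z = prec (α * β) x (prec β y z + succ α y z + dot y z)
  succ_prec : ∀ (α β : Ω) (x y z : D), prec β (succ α x y) z = succ α x (prec β y z)
  succ_succ : ∀ (α β : Ω) (x y z : D),
    succ (α * β) (prec β x y + succ α x y + dot x y) z = succ α x (succ β y z)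
  succ_dot : ∀ (α : Ω) (x y z : D), dot (succ α x y) z = succ α x (dot y z)
  prec_dot : ∀ (α : Ω) (x y z : D), dot (prec α x y) z = dot x (succ α y z)
  dot_prec : ∀ (α : Ω) (x y z : D), prec α (dot x y) z = dot x (prec α y z)
  dot_dot : ∀ (x y z : D), dot (dot x y) z = dot x (dot y z)

/-- Morphisms of tridendriform family algebras. -/
structure IsTridendriformFamilyHom {D E : Type*} [AddCommGroup D] [Module k D]
    [AddCommGroup E] [Module k E]
    (precD succD : Ω → D →ₗ[k] D →ₗ[k] D) (dotD : D →ₗ[k] D →ₗ[k] D)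
    (precE succE : Ω → E →ₗ[k] E →ₗ[k] E) (dotE : E →ₗ[k] E →ₗ[k] E)
    (F : D →ₗ[k] E) : Prop where
  map_prec : ∀ ω a b, F (precD ω a b) = precE ω (F a) (F b)
  map_succ : ∀ ω a b, F (succD ω a b) = succE ω (F a) (F b)
  map_dot : ∀ a b, F (dotD a b) = dotE (F a) (F b)

/-- `(D, prec, succ, dot)` together with `i : X → D` is the free tridendriform family algebra
on `X`. -/
def IsFreeTridendriformFamilyAlgebra {X D : Type*} [AddCommGroup D] [Module k D]
    (prec succ : Ω → D →ₗ[k] D →ₗ[k] D) (dot : D →ₗ[k] D →ₗ[k] D) (i : X → D) : Prop :=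
  IsTridendriformFamilyAlgebra prec succ dot ∧
  ∀ (E : Type w) [AddCommGroup E] [Module k E]
    (precE succE : Ω → E →ₗ[k] E →ₗ[k] E) (dotE : E →ₗ[k] E →ₗ[k] E),
    IsTridendriformFamilyAlgebra precE succE dotE →
    ∀ f : X → E, ∃! F : D →ₗ[k] E,
      IsTridendriformFamilyHom prec succ dot precE succE dotE F ∧ ∀ x, F (i x) = f x

/-- A submodule closed under all the operations `≺_ω`, `≻_ω`, `·`. -/
structure IsTridendriformFamilySubalgebra {E : Type*} [AddCommGroup E] [Module k E]
    (prec succ : Ω → E →ₗ[k] E →ₗ[k] E) (dot : E →ₗ[k] E →ₗ[k] E)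
    (S : Submodule k E) : Prop where
  prec_mem : ∀ ω, ∀ a ∈ S, ∀ b ∈ S, prec ω a b ∈ S
  succ_mem : ∀ ω, ∀ a ∈ S, ∀ b ∈ S, succ ω a b ∈ S
  dot_mem : ∀ a ∈ S, ∀ b ∈ S, dot a b ∈ S

/-- The operation `a ≺_ω b = a P_ω(b)`. -/
def inducedPrec {Ω : Type*} {A : Type*} [AddCommGroup A] [Module k A]
    (mul : A →ₗ[k] A →ₗ[k] A) (P : Ω → A →ₗ[k] A) (ω : Ω) : A →ₗ[k] A →ₗ[k] A :=
  mul.compl₂ (P ω)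

/-- The operation `a ≻_ω b = P_ω(a) b`. -/
def inducedSucc {Ω : Type*} {A : Type*} [AddCommGroup A] [Module k A]
    (mul : A →ₗ[k] A →ₗ[k] A) (P : Ω → A →ₗ[k] A) (ω : Ω) : A →ₗ[k] A →ₗ[k] A :=
  mul.comp (P ω)

end Abstract

/-- The bilinear extension of an operation given on a basis. -/
noncomputable def bilinearExtension {k : Type*} [CommRing k] {S : Type*}
    (op : S → S → (S →₀ k)) : (S →₀ k) →ₗ[k] (S →₀ k) →ₗ[k] (S →₀ k) :=
  Finsupp.linearCombination k (fun a => Finsupp.linearCombination k (op a))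

/-! # Typed angularly decorated planar rooted trees -/

/-- `X`-angularly decorated `Ω`-typed planar rooted trees (with at least one vertex), described
through the root vertex, whose incoming edges `b₁, …, bₙ₊₁` are listed from left to right and whose
angles carry the decorations `x₁, …, xₙ`, `n ≥ 0`:
`cons b₁ x₁ (cons b₂ x₂ (… (cons bₙ xₙ (single bₙ₊₁))))`.

An incoming edge is an element of `Option (Ω × PlanarTree X Ω)`: it is either a leaf `none` (the
tree `|`; leaves carry no type, equivalently the type `1`) or `some (ω, T)`, an internal edge of
type `ω ∈ Ω` that carries the tree `T`. -/
inductive PlanarTree (X Ω : Type*) where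
  | single (b : Option (Ω × PlanarTree X Ω)) : PlanarTree X Ω
  | cons (b : Option (Ω × PlanarTree X Ω)) (x : X) (T : PlanarTree X Ω) : PlanarTree X Ω

namespace PlanarTree

variable {k : Type*} [CommRing k] {X Ω : Type*}

/-- The tree with one vertex and one leaf. -/
def unit : PlanarTree X Ω := single none

/-- The tree with one vertex and two leaves, with angle `x`. -/
def corolla (x : X) : PlanarTree X Ω := cons none x (single none)

/-- Grafting on a new root by an internal edge of type `ω`. -/
def graft (ω : Ω) (T : PlanarTree X Ω) : PlanarTree X Ω := single (some (ω, T))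

/-- The product `T ⋄ T'` of two trees, for the weight `l`. The root vertices are identified, so that
the last incoming edge of `T` and the first incoming edge of `T'` meet. If one of the two is a leaf,
only the other one is kept. If they are internal edges `(α, S)` and `(β, S')`, they are replaced
by one internal edge of type `α * β` carrying
`B⁺_α(S) ⋄ S' + S ⋄ B⁺_β(S') + l • S ⋄ S'`, expanded linearly.
The first clause passes over the edges of `T` that are not the last one. -/
noncomputable def diamondBasis [Mul Ω] (l : k) :
    PlanarTree X Ω → PlanarTree X Ω → (PlanarTree X Ω →₀ k)
  | cons b x T, U => Finsupp.mapDomain (cons b x) (diamondBasis l T U)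
  | single none, U => Finsupp.single U 1
  | single (some (α, S)), single none => Finsupp.single (single (some (α, S))) 1
  | single (some (α, S)), cons none y V => Finsupp.single (cons (some (α, S)) y V) 1
  | single (some (α, S)), single (some (β, S')) =>
      Finsupp.mapDomain (fun R => single (some (α * β, R)))
        (diamondBasis l (graft α S) S' + diamondBasis l S (graft β S') + l • diamondBasis l S S')
  | single (some (α, S)), cons (some (β, S')) y V =>
      Finsupp.mapDomain (fun R => cons (some (α * β, R)) y V)
        (diamondBasis l (graft α S) S' + diamondBasis l S (graft β S') + l • diamondBasis l S S')
termination_by T U => sizeOf T + sizeOf U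
decreasing_by all_goals (simp [graft]; try omega)

/-- The product `⋄` on the free module on the trees. -/
noncomputable def diamond (k X Ω : Type*) [CommRing k] [Mul Ω] (l : k) :
    (PlanarTree X Ω →₀ k) →ₗ[k] (PlanarTree X Ω →₀ k) →ₗ[k] (PlanarTree X Ω →₀ k) :=
  bilinearExtension (diamondBasis l)

/-- The operator `B⁺_ω`. -/
noncomputable def graftOp (k X : Type*) [CommRing k] {Ω : Type*} (ω : Ω) :
    (PlanarTree X Ω →₀ k) →ₗ[k] (PlanarTree X Ω →₀ k) :=
  Finsupp.lmapDomain k k (graft ω)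

/-- The Schröder trees: every vertex has at least two incoming edges. -/
inductive IsSchroder : PlanarTree X Ω → Prop
  | pair {b : Option (Ω × PlanarTree X Ω)} {x : X} {c : Option (Ω × PlanarTree X Ω)}
      (hb : ∀ ω S, b = some (ω, S) → IsSchroder S)
      (hc : ∀ ω S, c = some (ω, S) → IsSchroder S) : IsSchroder (cons b x (single c))
  | cons {b : Option (Ω × PlanarTree X Ω)} {x : X} {T : PlanarTree X Ω}
      (hb : ∀ ω S, b = some (ω, S) → IsSchroder S)
      (hT : IsSchroder T) : IsSchroder (cons b x T)

/-- The span of the Schröder trees in the free module on all trees. -/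
def schroderSpan (k X Ω : Type*) [CommRing k] : Submodule k (PlanarTree X Ω →₀ k) :=
  Finsupp.supported k k {T | IsSchroder T}

end PlanarTree

/-! # Typed angularly decorated Schröder trees -/

/-- `X`-angularly decorated `Ω`-typed Schröder trees as a type of their own, described as
`PlanarTree`, except that every vertex has at least two incoming edges:
`cons b₁ x₁ (cons b₂ x₂ (… (pair bₙ xₙ bₙ₊₁)))` with `n ≥ 1`. -/
inductive SchroderTree (X Ω : Type*) where
  | pair (b : Option (Ω × SchroderTree X Ω)) (x : X) (c : Option (Ω × SchroderTree X Ω)) :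
      SchroderTree X Ω
  | cons (b : Option (Ω × SchroderTree X Ω)) (x : X) (T : SchroderTree X Ω) : SchroderTree X Ω

/-- Labels for the operations `≺_ω`, `≻_ω`, `·`. -/
inductive TriOp (Ω : Type*) where
  | prec (ω : Ω) : TriOp Ω
  | succ (ω : Ω) : TriOp Ω
  | dot : TriOp Ω

namespace SchroderTree

open TriOp

variable {k : Type*} [CommRing k] {X Ω : Type*}

/-- The tree with one vertex and two leaves, with angle `x`. -/
def corolla (x : X) : SchroderTree X Ω := pair none x none

/-- The recursive operations on Schröder trees.
* `T ≺_ω U` replaces the last incoming edge of the root of `T`: a leaf becomes `(ω, U)`, and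
  `(α, S)` becomes `(α * ω, S ≻_α U + S ≺_ω U + S · U)`.
* `T ≻_ω U` replaces the first incoming edge of the root of `U`: a leaf becomes `(ω, T)`, and
  `(β, V)` becomes `(ω * β, T ≻_ω V + T ≺_β V + T · V)`.
* `T · U` identifies the roots and merges the last incoming edge of `T` with the first one of `U`: if
  one of them is a leaf the other one is kept, and `(α, S)`, `(β, V)` become
  `(α * β, S ≻_α V + S ≺_β V + S · V)`. -/
noncomputable def opBasis (k : Type*) [CommRing k] [Mul Ω] :
    TriOp Ω → SchroderTree X Ω → SchroderTree X Ω → (SchroderTree X Ω →₀ k)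
  | prec ω, cons b x T, U => Finsupp.mapDomain (cons b x) (opBasis k (prec ω) T U)
  | prec ω, pair b x none, U => Finsupp.single (pair b x (some (ω, U))) 1
  | prec ω, pair b x (some (α, S)), U =>
      Finsupp.mapDomain (fun R => pair b x (some (α * ω, R)))
        (opBasis k (succ α) S U + opBasis k (prec ω) S U + opBasis k dot S U)
  | succ ω, T, pair none y c => Finsupp.single (pair (some (ω, T)) y c) 1
  | succ ω, T, cons none y U => Finsupp.single (cons (some (ω, T)) y U) 1
  | succ ω, T, pair (some (β, V)) y c =>
      Finsupp.mapDomain (fun R => pair (some (ω * β, R)) y c)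
        (opBasis k (succ ω) T V + opBasis k (prec β) T V + opBasis k dot T V)
  | succ ω, T, cons (some (β, V)) y U =>
      Finsupp.mapDomain (fun R => cons (some (ω * β, R)) y U)
        (opBasis k (succ ω) T V + opBasis k (prec β) T V + opBasis k dot T V)
  | dot, cons b x T, U => Finsupp.mapDomain (cons b x) (opBasis k dot T U)
  | dot, pair b x none, U => Finsupp.single (cons b x U) 1
  | dot, pair b x (some (α, S)), pair none y c =>
      Finsupp.single (cons b x (pair (some (α, S)) y c)) 1
  | dot, pair b x (some (α, S)), cons none y U =>
      Finsupp.single (cons b x (cons (some (α, S)) y U)) 1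
  | dot, pair b x (some (α, S)), pair (some (β, V)) y c =>
      Finsupp.mapDomain (fun R => cons b x (pair (some (α * β, R)) y c))
        (opBasis k (succ α) S V + opBasis k (prec β) S V + opBasis k dot S V)
  | dot, pair b x (some (α, S)), cons (some (β, V)) y U =>
      Finsupp.mapDomain (fun R => cons b x (cons (some (α * β, R)) y U))
        (opBasis k (succ α) S V + opBasis k (prec β) S V + opBasis k dot S V)
termination_by _ T U => sizeOf T + sizeOf U
decreasing_by all_goals (simp; try omega)

/-- The operation `≺_ω` on the free module on the Schröder trees. -/
noncomputable def precOp (k X : Type*) [CommRing k] {Ω : Type*} [Mul Ω] (ω : Ω) :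
    (SchroderTree X Ω →₀ k) →ₗ[k] (SchroderTree X Ω →₀ k) →ₗ[k] (SchroderTree X Ω →₀ k) :=
  bilinearExtension (opBasis k (prec ω))

/-- The operation `≻_ω` on the free module on the Schröder trees. -/
noncomputable def succOp (k X : Type*) [CommRing k] {Ω : Type*} [Mul Ω] (ω : Ω) :
    (SchroderTree X Ω →₀ k) →ₗ[k] (SchroderTree X Ω →₀ k) →ₗ[k] (SchroderTree X Ω →₀ k) :=
  bilinearExtension (opBasis k (succ ω))

/-- The operation `·` on the free module on the Schröder trees. -/
noncomputable def dotOp (k X Ω : Type*) [CommRing k] [Mul Ω] :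
    (SchroderTree X Ω →₀ k) →ₗ[k] (SchroderTree X Ω →₀ k) →ₗ[k] (SchroderTree X Ω →₀ k) :=
  bilinearExtension (opBasis k dot)

/-- A Schröder tree, seen as a planar rooted tree. -/
def toPlanar : SchroderTree X Ω → PlanarTree X Ω
  | pair none x none => .cons none x (.single none)
  | pair none x (some (β, S')) => .cons none x (.single (some (β, toPlanar S')))
  | pair (some (α, S)) x none => .cons (some (α, toPlanar S)) x (.single none)
  | pair (some (α, S)) x (some (β, S')) =>
      .cons (some (α, toPlanar S)) x (.single (some (β, toPlanar S')))
  | cons none x T => .cons none x (toPlanar T)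
  | cons (some (α, S)) x T => .cons (some (α, toPlanar S)) x (toPlanar T)

/-- The number of vertices. In the last two clauses the root of `T` is the root of the
whole tree. -/
def numVertices : SchroderTree X Ω → ℕ
  | pair none _ none => 1
  | pair none _ (some (_, S')) => 1 + numVertices S'
  | pair (some (_, S)) _ none => 1 + numVertices S
  | pair (some (_, S)) _ (some (_, S')) => 1 + numVertices S + numVertices S'
  | cons none _ T => numVertices T
  | cons (some (_, S)) _ T => numVertices S + numVertices T

/-- The canonical inclusion of the free module on the Schröder trees into the free module on all
trees. -/
noncomputable def inclusion (k X Ω : Type*) [CommRing k] :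
    (SchroderTree X Ω →₀ k) →ₗ[k] (PlanarTree X Ω →₀ k) :=
  Finsupp.lmapDomain k k toPlanar

/-- The canonical inclusion, rescaled by one factor `c` for each vertex: `T ↦ c ^ |V(T)| • T`. -/
noncomputable def rescaledInclusion (k X Ω : Type*) [CommRing k] (c : k) :
    (SchroderTree X Ω →₀ k) →ₗ[k] (PlanarTree X Ω →₀ k) :=
  Finsupp.linearCombination k (fun T => Finsupp.single (toPlanar T) (c ^ numVertices T))

end SchroderTree

/-! In the free Rota–Baxter family algebra everything follows from two rules. The first concerns
joining two trees at the root with a new angle `x` in between, which is `T ⋄ Y_x ⋄ U`: since `⋄`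
only merges the two edges that meet, it commutes with such joins on either side
(`diamond_appendOp_left`, `diamond_appendOp_right`). The second is the recursive clause for two
grafted trees, which is the Rota–Baxter identity itself (`diamond_graftOp_graftOp`). Induction on
size reduces associativity, and the multiplicativity of evaluation in an arbitrary Rota–Baxter
family algebra, to products of grafted trees. Uniqueness holds because joins, grafting and the unit
build every tree. For Schröder trees the axioms are not checked on the recursive operations.
Instead, `evalHom_opBasis` shows that evaluation into any tridendriform family algebra respects
these operations, a statement that only uses the axioms of the target. Taking as target the planar
trees with the operations induced by `⋄` and sending `x` to `λ⁻¹ Y_x`, evaluation turns out to be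
the inclusion rescaled by `λ⁻¹` per vertex (`rescaledInclusion_eq_evalHom`). So this inclusion is a
morphism. It is injective, and for `λ = 1` the axioms pull back along it; with evaluation as the
universal map, this gives freeness. The image of a morphism is closed under the operations, hence so
is the span of the Schröder trees. -/

section Linear

/-! ### Linear preliminaries and the tridendriform structure induced by Rota–Baxter operators -/

variable {k : Type*} [CommRing k]

/-- Induction for statements on a free module that are linear in one variable. -/
@[elab_as_elim]
theorem finsupp_induction_basis {S : Type*} {p : (S →₀ k) → Prop} (a : S →₀ k)
    (zero : p 0) (add : ∀ a b, p a → p b → p (a + b)) (smul : ∀ (r : k) a, p a → p (r • a))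
    (basis : ∀ s, p (Finsupp.single s 1)) : p a := by
  induction a using Finsupp.induction_linear with
  | zero => exact zero
  | add a b ha hb => exact add a b ha hb
  | single s r =>
    have := smul r _ (basis s)
    rwa [Finsupp.smul_single_one] at this

theorem bilinearExtension_single {S : Type*} (op : S → S → (S →₀ k)) (a b : S) :
    bilinearExtension op (Finsupp.single a 1) (Finsupp.single b 1) = op a b := by
  simp [bilinearExtension]

/-- A Rota-Baxter family algebra of weight `l` is a tridendriform family algebra. -/
theorem IsRotaBaxterFamilyAlgebra.isTridendriformFamilyAlgebra {Ω : Type*} [Semigroup Ω]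
    {A : Type*} [AddCommGroup A] [Module k A] {l : k} {mul : A →ₗ[k] A →ₗ[k] A} {one : A}
    {P : Ω → A →ₗ[k] A} (h : IsRotaBaxterFamilyAlgebra l mul one P) :
    IsTridendriformFamilyAlgebra (inducedPrec mul P) (inducedSucc mul P) (l • mul) where
  prec_prec α β x y z := by
    simp only [inducedPrec, inducedSucc, LinearMap.compl₂_apply, LinearMap.comp_apply,
      LinearMap.smul_apply, h.mul_assoc, h.rotaBaxter]
    congr 2
    abel
  succ_prec α β x y z := by
    simp only [inducedPrec, inducedSucc, LinearMap.compl₂_apply, LinearMap.comp_apply,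
      h.mul_assoc]
  succ_succ α β x y z := by
    simp only [inducedPrec, inducedSucc, LinearMap.compl₂_apply, LinearMap.comp_apply,
      LinearMap.smul_apply, ← h.mul_assoc, h.rotaBaxter]
    congr 3
    abel
  succ_dot α x y z := by
    simp only [inducedSucc, LinearMap.comp_apply, LinearMap.smul_apply, h.mul_assoc, map_smul]
  prec_dot α x y z := by
    simp only [inducedPrec, inducedSucc, LinearMap.compl₂_apply, LinearMap.comp_apply,
      LinearMap.smul_apply, h.mul_assoc]
  dot_prec α x y z := by
    simp only [inducedPrec, LinearMap.compl₂_apply, LinearMap.smul_apply, map_smul, h.mul_assoc]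
  dot_dot x y z := by
    simp only [LinearMap.smul_apply, map_smul, h.mul_assoc]

end Linear

/-! ### Planar trees: joining at the root, grafting, evaluation -/

namespace PlanarTree

variable {k : Type*} [CommRing k] {X Ω : Type*}

-- The type is nested through `Option` and a product, so its generated recursor carries auxiliary
-- motives. This form has a single motive and splits each first edge into leaf or internal edge.
@[elab_as_elim]
theorem tree_induction {p : PlanarTree X Ω → Prop} (T : PlanarTree X Ω)
    (single_none : p (single none))
    (single_some : ∀ α S, p S → p (single (some (α, S))))
    (cons_none : ∀ x T, p T → p (cons none x T))
    (cons_some : ∀ α S x T, p S → p T → p (cons (some (α, S)) x T)) : p T :=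
  match T with
  | single none => single_none
  | single (some (α, S)) =>
    single_some α S (tree_induction S single_none single_some cons_none cons_some)
  | cons none x T =>
    cons_none x T (tree_induction T single_none single_some cons_none cons_some)
  | cons (some (α, S)) x T =>
    cons_some α S x T (tree_induction S single_none single_some cons_none cons_some)
      (tree_induction T single_none single_some cons_none cons_some)
termination_by sizeOf T

/-- Makes the size drop strictly when `cons b x V` is cut down to `single b`. -/
theorem sizeOf_pos (T : PlanarTree X Ω) : 0 < sizeOf T := by
  cases T <;> simp

/-- Identification of the roots, with a new angle `y` in between. -/
def append (y : X) : PlanarTree X Ω → PlanarTree X Ω → PlanarTree X Ω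
  | single b, V => cons b y V
  | cons b x T, V => cons b x (append y T V)

theorem append_assoc (x y : X) (T U V : PlanarTree X Ω) :
    append y (append x T U) V = append x T (append y U V) := by
  induction T using tree_induction <;> simp_all [append]

/-- The bilinear extension of `append`. -/
noncomputable def appendOp (k Ω : Type*) [CommRing k] (y : X) :
    (PlanarTree X Ω →₀ k) →ₗ[k] (PlanarTree X Ω →₀ k) →ₗ[k] (PlanarTree X Ω →₀ k) :=
  bilinearExtension (fun T V => Finsupp.single (append y T V) 1)

theorem appendOp_basis (y : X) (T V : PlanarTree X Ω) :
    appendOp k Ω y (Finsupp.single T 1) (Finsupp.single V 1) =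
      Finsupp.single (append y T V) 1 :=
  bilinearExtension_single _ _ _

theorem appendOp_single_left (y : X) (T : PlanarTree X Ω) (a : PlanarTree X Ω →₀ k) :
    appendOp k Ω y (Finsupp.single T 1) a = Finsupp.mapDomain (append y T) a := by
  induction a using finsupp_induction_basis with
  | zero => simp
  | add a b ha hb => simp [Finsupp.mapDomain_add, ha, hb]
  | smul r a ha => simp [Finsupp.mapDomain_smul, ha]
  | basis s => simp [appendOp_basis, Finsupp.mapDomain_single]

theorem appendOp_single_right (y : X) (V : PlanarTree X Ω) (a : PlanarTree X Ω →₀ k) :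
    appendOp k Ω y a (Finsupp.single V 1) = Finsupp.mapDomain (fun R => append y R V) a := by
  induction a using finsupp_induction_basis with
  | zero => simp
  | add a b ha hb => simp [Finsupp.mapDomain_add, ha, hb]
  | smul r a ha => simp [Finsupp.mapDomain_smul, ha]
  | basis s => simp [appendOp_basis, Finsupp.mapDomain_single]

theorem graftOp_basis (α : Ω) (S : PlanarTree X Ω) :
    graftOp k X α (Finsupp.single S 1) = Finsupp.single (graft α S) 1 := by
  simp [graftOp, Finsupp.mapDomain_single]

theorem cons_eq_appendOp (b : Option (Ω × PlanarTree X Ω)) (x : X) (T : PlanarTree X Ω) :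
    Finsupp.single (cons b x T) (1 : k) =
      appendOp k Ω x (Finsupp.single (single b) 1) (Finsupp.single T 1) := by
  rw [appendOp_basis, append]

theorem single_some_eq_graftOp (α : Ω) (S : PlanarTree X Ω) :
    Finsupp.single (single (some (α, S))) (1 : k) = graftOp k X α (Finsupp.single S 1) := by
  rw [graftOp_basis, graft]

theorem single_none_eq_unit :
    Finsupp.single (single none) (1 : k) = Finsupp.single (unit : PlanarTree X Ω) 1 := rfl

section Universal

variable {R : Type*} [AddCommGroup R] [Module k R] (mulR : R →ₗ[k] R →ₗ[k] R) (oneR : R)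
  (PR : Ω → R →ₗ[k] R) (f : X → R)

/-- The evaluation of a tree in a Rota-Baxter family algebra. -/
def eval : PlanarTree X Ω → R
  | single none => oneR
  | single (some (α, S)) => PR α (eval S)
  | cons none x T => mulR (f x) (eval T)
  | cons (some (α, S)) x T => mulR (PR α (eval S)) (mulR (f x) (eval T))
termination_by T => sizeOf T

/-- The linear extension of `eval`. -/
noncomputable def evalHom : (PlanarTree X Ω →₀ k) →ₗ[k] R :=
  Finsupp.linearCombination k (eval mulR oneR PR f)

theorem evalHom_basis (T : PlanarTree X Ω) :
    evalHom mulR oneR PR f (Finsupp.single T 1) = eval mulR oneR PR f T := by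
  simp [evalHom]

theorem evalHom_graftOp (α : Ω) (a : PlanarTree X Ω →₀ k) :
    evalHom mulR oneR PR f (graftOp k X α a) = PR α (evalHom mulR oneR PR f a) := by
  induction a using finsupp_induction_basis with
  | zero => simp
  | add a b ha hb => simp [ha, hb]
  | smul r a ha => simp [ha]
  | basis T => rw [graftOp_basis, evalHom_basis, evalHom_basis, graft, eval]

end Universal

/-! ### The product `⋄` against joins and grafts -/

variable [Mul Ω] (l : k)

theorem diamond_basis (T U : PlanarTree X Ω) :
    diamond k X Ω l (Finsupp.single T 1) (Finsupp.single U 1) = diamondBasis l T U :=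
  bilinearExtension_single _ _ _

/-- Only the last incoming edge of the left factor takes part in the merging, and it belongs to `U`;
all of `T` is carried along. -/
theorem diamondBasis_append_left (y : X) (T U V : PlanarTree X Ω) :
    diamondBasis l (append y T U) V = Finsupp.mapDomain (append y T) (diamondBasis l U V) := by
  have hs (b) : append (Ω := Ω) y (single b) = cons b y := funext fun V => by simp [append]
  have hc (b x) (T : PlanarTree X Ω) : append y (cons b x T) = cons b x ∘ append y T :=
    funext fun V => by simp [append]
  induction T using tree_induction with
  | single_none => rw [hs, diamondBasis]
  | single_some => rw [hs, diamondBasis]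
  | cons_none x T ih => rw [hc, Function.comp_apply, diamondBasis, ih, Finsupp.mapDomain_comp]
  | cons_some α S x T _ ih =>
    rw [hc, Function.comp_apply, diamondBasis, ih, Finsupp.mapDomain_comp]

/-- On the right only the first edge `b` is merged. The recursion runs through the left factor, so
this mirror statement needs an induction on `T`. -/
theorem diamondBasis_cons_right (b : Option (Ω × PlanarTree X Ω)) (y : X)
    (T V : PlanarTree X Ω) :
    diamondBasis l T (cons b y V) =
      Finsupp.mapDomain (fun R => append y R V) (diamondBasis l T (single b)) := by
  induction T using tree_induction with
  | single_none => simp [diamondBasis, Finsupp.mapDomain_single, append]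
  | single_some α S _ =>
    rcases b with _ | ⟨β, S'⟩
    · simp [diamondBasis, Finsupp.mapDomain_single, append]
    · rw [diamondBasis, diamondBasis, ← Finsupp.mapDomain_comp]
      rfl
  | cons_none x T ih =>
    rw [diamondBasis, ih, diamondBasis, ← Finsupp.mapDomain_comp, ← Finsupp.mapDomain_comp]
    rfl
  | cons_some α S x T _ ih =>
    rw [diamondBasis, ih, diamondBasis, ← Finsupp.mapDomain_comp, ← Finsupp.mapDomain_comp]
    rfl

theorem diamondBasis_append_right (y : X) (T U V : PlanarTree X Ω) :
    diamondBasis l T (append y U V) =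
      Finsupp.mapDomain (fun R => append y R V) (diamondBasis l T U) := by
  cases U with
  | single b => rw [append, diamondBasis_cons_right]
  | cons b x U =>
    rw [append, diamondBasis_cons_right, diamondBasis_cons_right, ← Finsupp.mapDomain_comp]
    congr 1
    funext R
    simp [append_assoc]

theorem diamond_appendOp_left (y : X) (a b c : PlanarTree X Ω →₀ k) :
    diamond k X Ω l (appendOp k Ω y a b) c = appendOp k Ω y a (diamond k X Ω l b c) := by
  induction a using finsupp_induction_basis with
  | zero => simp
  | add a b ha hb => simp [ha, hb]
  | smul r a ha => simp [ha]
  | basis T =>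
  induction b using finsupp_induction_basis with
  | zero => simp
  | add a b ha hb => simp [ha, hb]
  | smul r a ha => simp [ha]
  | basis U =>
  induction c using finsupp_induction_basis with
  | zero => simp
  | add a b ha hb => simp [ha, hb]
  | smul r a ha => simp [ha]
  | basis V =>
    rw [appendOp_basis, diamond_basis, diamond_basis, appendOp_single_left,
      diamondBasis_append_left]

theorem diamond_appendOp_right (y : X) (a b c : PlanarTree X Ω →₀ k) :
    diamond k X Ω l a (appendOp k Ω y b c) = appendOp k Ω y (diamond k X Ω l a b) c := by
  induction a using finsupp_induction_basis with
  | zero => simp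
  | add a b ha hb => simp [ha, hb]
  | smul r a ha => simp [ha]
  | basis T =>
  induction b using finsupp_induction_basis with
  | zero => simp
  | add a b ha hb => simp [ha, hb]
  | smul r a ha => simp [ha]
  | basis U =>
  induction c using finsupp_induction_basis with
  | zero => simp
  | add a b ha hb => simp [ha, hb]
  | smul r a ha => simp [ha]
  | basis V =>
    rw [appendOp_basis, diamond_basis, diamond_basis, appendOp_single_right,
      diamondBasis_append_right]

/-- The clause for two internal edges, extended bilinearly: the Rota–Baxter identity is built into
the product. -/
theorem diamond_graftOp_graftOp (α β : Ω) (a b : PlanarTree X Ω →₀ k) :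
    diamond k X Ω l (graftOp k X α a) (graftOp k X β b) =
      graftOp k X (α * β) (diamond k X Ω l (graftOp k X α a) b +
        diamond k X Ω l a (graftOp k X β b) + l • diamond k X Ω l a b) := by
  induction a using finsupp_induction_basis with
  | zero => simp
  | add a b ha hb => simp only [map_add, LinearMap.add_apply, ha, hb, smul_add]; abel
  | smul r a ha => simp only [map_add, map_smul, LinearMap.smul_apply, ha, smul_add,
      smul_comm l r]
  | basis T =>
  induction b using finsupp_induction_basis with
  | zero => simp
  | add a b ha hb => simp only [map_add, ha, hb, smul_add]; abel
  | smul r a ha => simp only [map_add, map_smul, ha, smul_add, smul_comm l r]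
  | basis U =>
    simp only [graftOp_basis, diamond_basis]
    rw [graft, graft, diamondBasis]
    rfl

theorem unit_diamond (a : PlanarTree X Ω →₀ k) :
    diamond k X Ω l (Finsupp.single unit 1) a = a := by
  induction a using finsupp_induction_basis with
  | zero => simp
  | add a b ha hb => simp [ha, hb]
  | smul r a ha => simp [ha]
  | basis U => rw [diamond_basis, unit, diamondBasis]

theorem diamond_unit (a : PlanarTree X Ω →₀ k) :
    diamond k X Ω l a (Finsupp.single unit 1) = a := by
  induction a using finsupp_induction_basis with
  | zero => simp
  | add a b ha hb => simp [ha, hb]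
  | smul r a ha => simp [ha]
  | basis U =>
    rw [diamond_basis, unit]
    induction U using tree_induction <;> simp_all [diamondBasis, Finsupp.mapDomain_single]

end PlanarTree

/-! ### Associativity of `⋄` and freeness among Rota–Baxter family algebras -/

namespace PlanarTree

variable {k : Type*} [CommRing k] {X Ω : Type*} [Semigroup Ω] (l : k)

/-- Induction on the total size. Edges of `T` before its last one, and of `V` after its first one,
are passive and can be split off. If `U` has several edges, the two mergings take place at different
edges and do not interact. Units aside, three grafted trees remain. -/
theorem diamond_assoc_basis (n : ℕ) : ∀ T U V : PlanarTree X Ω,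
    sizeOf T + sizeOf U + sizeOf V < n →
    diamond k X Ω l (diamond k X Ω l (Finsupp.single T 1) (Finsupp.single U 1))
      (Finsupp.single V 1) =
    diamond k X Ω l (Finsupp.single T 1)
      (diamond k X Ω l (Finsupp.single U 1) (Finsupp.single V 1)) := by
  induction n with
  | zero => intros; omega
  | succ n ih =>
  intro T U V h
  rcases T with (_ | ⟨α, S⟩) | ⟨b, x, T⟩
  · rw [single_none_eq_unit, unit_diamond, unit_diamond]
  · rcases U with (_ | ⟨β, S'⟩) | ⟨b, x, U⟩
    · rw [single_none_eq_unit, unit_diamond, diamond_unit]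
    · rcases V with (_ | ⟨γ, S''⟩) | ⟨b, x, V⟩
      · rw [single_none_eq_unit, diamond_unit, diamond_unit]
      -- One instance for each choice of which factors stay grafted, except all three: these are the
      -- seven terms of the double Rota–Baxter expansion.
      · have e1 := ih (graft α S) (graft β S') S'' (by simp [graft] at h ⊢; omega)
        have e2 := ih (graft α S) S' (graft γ S'') (by simp [graft] at h ⊢; omega)
        have e3 := ih S (graft β S') (graft γ S'') (by simp [graft] at h ⊢; omega)
        have e4 := ih (graft α S) S' S'' (by simp [graft] at h ⊢; omega)
        have e5 := ih S (graft β S') S'' (by simp [graft] at h ⊢; omega)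
        have e6 := ih S S' (graft γ S'') (by simp [graft] at h ⊢; omega)
        have e7 := ih S S' S'' (by simp at h ⊢; omega)
        simp only [← graftOp_basis] at e1 e2 e3 e4 e5 e6
        simp only [single_some_eq_graftOp]
        -- Both sides become a graft of type `αβγ`. The reversed rewrites then refold the inner
        -- products of two grafts, so that the terms have the form treated by `e1` and its
        -- companions.
        rw [diamond_graftOp_graftOp l α β, diamond_graftOp_graftOp l β γ,
          diamond_graftOp_graftOp, diamond_graftOp_graftOp, ← diamond_graftOp_graftOp l α β,
          ← diamond_graftOp_graftOp l β γ, mul_assoc]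
        congr 1
        simp only [map_add, map_smul, LinearMap.add_apply, LinearMap.smul_apply, smul_add,
          e1, e2, e3, e4, e5, e6, e7]
        abel
      · rw [cons_eq_appendOp, diamond_appendOp_right, diamond_appendOp_right,
          diamond_appendOp_right, ih _ _ _ (by have := V.sizeOf_pos; simp at h ⊢; omega)]
    · rw [cons_eq_appendOp, diamond_appendOp_right, diamond_appendOp_left, diamond_appendOp_left,
        diamond_appendOp_right]
  · rw [cons_eq_appendOp, diamond_appendOp_left, diamond_appendOp_left, diamond_appendOp_left,
      ih _ _ _ (by simp at h ⊢; omega)]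

theorem isRotaBaxterFamilyAlgebra_diamond :
    IsRotaBaxterFamilyAlgebra l (diamond k X Ω l) (Finsupp.single unit 1) (graftOp k X) where
  mul_assoc a b c := by
    induction a using finsupp_induction_basis with
    | zero => simp
    | add a b ha hb => simp [ha, hb]
    | smul r a ha => simp [ha]
    | basis T =>
    induction b using finsupp_induction_basis with
    | zero => simp
    | add a b ha hb => simp [ha, hb]
    | smul r a ha => simp [ha]
    | basis U =>
    induction c using finsupp_induction_basis with
    | zero => simp
    | add a b ha hb => simp [ha, hb]
    | smul r a ha => simp [ha]
    | basis V => exact diamond_assoc_basis l _ T U V (Nat.lt_succ_self _)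
  one_mul := unit_diamond l
  mul_one := diamond_unit l
  rotaBaxter := diamond_graftOp_graftOp l

section Universal

variable {R : Type*} [AddCommGroup R] [Module k R] {mulR : R →ₗ[k] R →ₗ[k] R} {oneR : R}
  {PR : Ω → R →ₗ[k] R} {l} (f : X → R)

theorem evalHom_appendOp (h : IsRotaBaxterFamilyAlgebra l mulR oneR PR) (y : X) (a b : PlanarTree X Ω →₀ k) :
    evalHom mulR oneR PR f (appendOp k Ω y a b) =
      mulR (evalHom mulR oneR PR f a) (mulR (f y) (evalHom mulR oneR PR f b)) := by
  induction a using finsupp_induction_basis with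
  | zero => simp
  | add a b ha hb => simp [ha, hb]
  | smul r a ha => simp [ha]
  | basis T =>
  induction b using finsupp_induction_basis with
  | zero => simp
  | add a b ha hb => simp [ha, hb]
  | smul r a ha => simp [ha]
  | basis U =>
    simp only [appendOp_basis, evalHom_basis]
    induction T using tree_induction <;>
      simp_all [append, eval, h.one_mul, h.mul_assoc]

/-- The reduction used for associativity applies: joins are handled by `evalHom_appendOp`, and for
two grafts the Rota–Baxter identity in the source matches the one in the target. -/
theorem evalHom_diamond_basis (h : IsRotaBaxterFamilyAlgebra l mulR oneR PR) (n : ℕ) : ∀ T U : PlanarTree X Ω,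
    sizeOf T + sizeOf U < n →
    evalHom mulR oneR PR f (diamond k X Ω l (Finsupp.single T 1) (Finsupp.single U 1)) =
      mulR (evalHom mulR oneR PR f (Finsupp.single T 1))
        (evalHom mulR oneR PR f (Finsupp.single U 1)) := by
  have h1 : evalHom (k := k) mulR oneR PR f (Finsupp.single unit 1) = oneR := by
    rw [evalHom_basis, unit, eval]
  induction n with
  | zero => intros; omega
  | succ n ih =>
  intro T U hn
  rcases T with (_ | ⟨α, S⟩) | ⟨b, x, T⟩
  · rw [single_none_eq_unit, unit_diamond, h1, h.one_mul]
  · rcases U with (_ | ⟨β, S'⟩) | ⟨b, x, U⟩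
    · rw [single_none_eq_unit, diamond_unit, h1, h.mul_one]
    · have e1 := ih (graft α S) S' (by simp [graft] at hn ⊢; omega)
      have e2 := ih S (graft β S') (by simp [graft] at hn ⊢; omega)
      have e3 := ih S S' (by simp at hn ⊢; omega)
      simp only [← graftOp_basis] at e1 e2
      simp only [single_some_eq_graftOp]
      rw [diamond_graftOp_graftOp, evalHom_graftOp, map_add (evalHom mulR oneR PR f),
        map_add (evalHom mulR oneR PR f), map_smul (evalHom mulR oneR PR f), e1, e2, e3,
        evalHom_graftOp, evalHom_graftOp, h.rotaBaxter]
    · rw [cons_eq_appendOp, diamond_appendOp_right, evalHom_appendOp f h,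
        ih _ _ (by have := U.sizeOf_pos; simp at hn ⊢; omega), evalHom_appendOp f h, h.mul_assoc]
  · rw [cons_eq_appendOp, diamond_appendOp_left, evalHom_appendOp f h,
      ih _ _ (by simp at hn ⊢; omega), evalHom_appendOp f h, h.mul_assoc, h.mul_assoc]

theorem isRotaBaxterFamilyHom_evalHom (h : IsRotaBaxterFamilyAlgebra l mulR oneR PR) :
    IsRotaBaxterFamilyHom (diamond k X Ω l) (Finsupp.single unit 1) (graftOp k X)
      mulR oneR PR (evalHom mulR oneR PR f) where
  map_mul a b := by
    induction a using finsupp_induction_basis with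
    | zero => simp
    | add a b ha hb => simp [ha, hb]
    | smul r a ha => simp [ha]
    | basis T =>
    induction b using finsupp_induction_basis with
    | zero => simp
    | add a b ha hb => simp [ha, hb]
    | smul r a ha => simp [ha]
    | basis U => exact evalHom_diamond_basis f h _ T U (Nat.lt_succ_self _)
  map_one := by rw [evalHom_basis, unit, eval]
  map_op ω a := evalHom_graftOp mulR oneR PR f ω a

end Universal

theorem corolla_diamond (x : X) (a : PlanarTree X Ω →₀ k) :
    diamond k X Ω l (Finsupp.single (corolla x) 1) a =
      appendOp k Ω x (Finsupp.single unit 1) a := by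
  rw [corolla, cons_eq_appendOp, diamond_appendOp_left, single_none_eq_unit, unit_diamond]

/-- Expresses joins through the algebra structure. Hence the corollas generate all trees, which
gives uniqueness in the universal property. -/
theorem appendOp_eq_diamond (x : X) (a b : PlanarTree X Ω →₀ k) :
    appendOp k Ω x a b =
      diamond k X Ω l a (diamond k X Ω l (Finsupp.single (corolla x) 1) b) := by
  rw [corolla_diamond, diamond_appendOp_right, diamond_unit]

theorem isFreeRotaBaxterFamilyAlgebra_diamond :
    IsFreeRotaBaxterFamilyAlgebra.{w} l (diamond k X Ω l) (Finsupp.single unit 1) (graftOp k X)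
      (fun x : X => Finsupp.single (corolla x) 1) := by
  refine ⟨isRotaBaxterFamilyAlgebra_diamond l, fun R _ _ mulR oneR PR h f =>
    ⟨evalHom mulR oneR PR f, ⟨isRotaBaxterFamilyHom_evalHom f h, fun x => ?_⟩, ?_⟩⟩
  · rw [evalHom_basis, corolla, eval, eval, h.mul_one]
  · rintro F ⟨hF, hf⟩
    refine Finsupp.lhom_ext' fun T => LinearMap.ext_ring ?_
    simp only [LinearMap.comp_apply, Finsupp.lsingle_apply, evalHom_basis]
    induction T using tree_induction with
    | single_none => rw [eval]; exact hF.map_one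
    | single_some α S ih => rw [single_some_eq_graftOp, hF.map_op, ih, eval]
    | cons_none x T ih =>
      rw [cons_eq_appendOp, appendOp_eq_diamond l, hF.map_mul, hF.map_mul, ih, hf, eval,
        single_none_eq_unit, hF.map_one, h.one_mul]
    | cons_some α S x T ihS ih =>
      rw [cons_eq_appendOp, appendOp_eq_diamond l, hF.map_mul, hF.map_mul, ih, hf, eval,
        single_some_eq_graftOp, hF.map_op, ihS]

end PlanarTree

/-! ### Schröder trees: induction and evaluation -/

namespace SchroderTree

open TriOp

variable {k : Type*} [CommRing k] {X Ω : Type*}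

@[elab_as_elim]
theorem tree_induction {p : SchroderTree X Ω → Prop} (T : SchroderTree X Ω)
    (pair_none_none : ∀ x, p (pair none x none))
    (pair_none_some : ∀ x β S', p S' → p (pair none x (some (β, S'))))
    (pair_some_none : ∀ α S x, p S → p (pair (some (α, S)) x none))
    (pair_some_some : ∀ α S x β S', p S → p S' → p (pair (some (α, S)) x (some (β, S'))))
    (cons_none : ∀ x T, p T → p (cons none x T))
    (cons_some : ∀ α S x T, p S → p T → p (cons (some (α, S)) x T)) : p T := by
  have key : ∀ n, ∀ T : SchroderTree X Ω, sizeOf T < n → p T := by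
    intro n
    induction n with
    | zero => intros; omega
    | succ n ih =>
      rintro (⟨_ | ⟨α, S⟩, x, _ | ⟨β, S'⟩⟩ | ⟨_ | ⟨α, S⟩, x, T⟩) h
      · exact pair_none_none x
      · exact pair_none_some x β S' (ih _ (by simp at h ⊢; omega))
      · exact pair_some_none α S x (ih _ (by simp at h ⊢; omega))
      · exact pair_some_some α S x β S' (ih _ (by simp at h ⊢; omega))
          (ih _ (by simp at h ⊢; omega))
      · exact cons_none x T (ih _ (by simp at h ⊢; omega))
      · exact cons_some α S x T (ih _ (by simp at h ⊢; omega)) (ih _ (by simp at h ⊢; omega))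
  exact key _ T (Nat.lt_succ_self _)

section Universal

variable {E : Type*} [AddCommGroup E] [Module k E] (precE succE : Ω → E →ₗ[k] E →ₗ[k] E)
  (dotE : E →ₗ[k] E →ₗ[k] E) (f : X → E)

/-- The evaluation of a Schröder tree in a tridendriform family algebra. -/
def eval : SchroderTree X Ω → E
  | pair none x none => f x
  | pair none x (some (β, S')) => precE β (f x) (eval S')
  | pair (some (α, S)) x none => succE α (eval S) (f x)
  | pair (some (α, S)) x (some (β, S')) => succE α (eval S) (precE β (f x) (eval S'))
  | cons none x T => dotE (f x) (eval T)
  | cons (some (α, S)) x T => succE α (eval S) (dotE (f x) (eval T))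
termination_by T => sizeOf T

/-- The left action of an incoming edge on a tridendriform family algebra. -/
def branchAction : Option (Ω × SchroderTree X Ω) → E →ₗ[k] E
  | none => LinearMap.id
  | some (α, S) => succE α (eval precE succE dotE f S)

theorem eval_cons (b : Option (Ω × SchroderTree X Ω)) (x : X) (T : SchroderTree X Ω) :
    eval precE succE dotE f (cons b x T) =
      branchAction precE succE dotE f b (dotE (f x) (eval precE succE dotE f T)) := by
  rcases b with _ | ⟨α, S⟩ <;> simp [eval, branchAction]

theorem eval_pair_none (b : Option (Ω × SchroderTree X Ω)) (x : X) :
    eval precE succE dotE f (pair b x none) = branchAction precE succE dotE f b (f x) := by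
  rcases b with _ | ⟨α, S⟩ <;> simp [eval, branchAction]

theorem eval_pair_some (b : Option (Ω × SchroderTree X Ω)) (x : X) (β : Ω)
    (S : SchroderTree X Ω) :
    eval precE succE dotE f (pair b x (some (β, S))) =
      branchAction precE succE dotE f b (precE β (f x) (eval precE succE dotE f S)) := by
  rcases b with _ | ⟨α, S⟩ <;> simp [eval, branchAction]

theorem eval_some_pair (α : Ω) (S : SchroderTree X Ω) (x : X)
    (c : Option (Ω × SchroderTree X Ω)) :
    eval precE succE dotE f (pair (some (α, S)) x c) =
      succE α (eval precE succE dotE f S) (eval precE succE dotE f (pair none x c)) := by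
  rcases c with _ | ⟨α, S⟩ <;> simp [eval]

theorem eval_some_cons (α : Ω) (S : SchroderTree X Ω) (x : X) (T : SchroderTree X Ω) :
    eval precE succE dotE f (cons (some (α, S)) x T) =
      succE α (eval precE succE dotE f S) (eval precE succE dotE f (cons none x T)) := by
  simp [eval]

/-- The linear extension of `eval`. -/
noncomputable def evalHom : (SchroderTree X Ω →₀ k) →ₗ[k] E :=
  Finsupp.linearCombination k (eval precE succE dotE f)

theorem evalHom_basis (T : SchroderTree X Ω) :
    evalHom precE succE dotE f (Finsupp.single T 1) = eval precE succE dotE f T := by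
  simp [evalHom]

/-- Each recursive clause of `opBasis` plugs a linear combination into a fixed context `g`. If the
context evaluates to a linear map, evaluation passes through it. -/
theorem evalHom_mapDomain (g : SchroderTree X Ω → SchroderTree X Ω) (L : E →ₗ[k] E)
    (h : ∀ T, eval precE succE dotE f (g T) = L (eval precE succE dotE f T))
    (a : SchroderTree X Ω →₀ k) :
    evalHom precE succE dotE f (Finsupp.mapDomain g a) = L (evalHom precE succE dotE f a) := by
  rw [evalHom, Finsupp.linearCombination_mapDomain, Finsupp.apply_linearCombination]
  congr 2
  exact funext h

/-- The operation with a given label. -/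
def interpret : TriOp Ω → E →ₗ[k] E →ₗ[k] E
  | prec ω => precE ω
  | succ ω => succE ω
  | dot => dotE

end Universal

/-! ### Evaluation is the unique morphism extending a map on the generators -/

section Hom

variable [Semigroup Ω] {E : Type*} [AddCommGroup E] [Module k E]
  {precE succE : Ω → E →ₗ[k] E →ₗ[k] E} {dotE : E →ₗ[k] E →ₗ[k] E}

/-- A first edge acts by some `≻`, which the axioms let slide out of a left argument; this makes the
edge `b` passive in the computations below. -/
theorem prec_branchAction (h : IsTridendriformFamilyAlgebra precE succE dotE) (f : X → E)
    (b : Option (Ω × SchroderTree X Ω)) (ω : Ω) (u v : E) :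
    precE ω (branchAction precE succE dotE f b u) v =
      branchAction precE succE dotE f b (precE ω u v) := by
  rcases b with _ | ⟨α, S⟩ <;> simp [branchAction, h.succ_prec]

theorem dot_branchAction (h : IsTridendriformFamilyAlgebra precE succE dotE) (f : X → E)
    (b : Option (Ω × SchroderTree X Ω)) (u v : E) :
    dotE (branchAction precE succE dotE f b u) v =
      branchAction precE succE dotE f b (dotE u v) := by
  rcases b with _ | ⟨α, S⟩ <;> simp [branchAction, h.succ_dot]

/-- The operations call one another, so all labels are treated in one induction on the sum of the
sizes. Each recursive clause of `opBasis` mirrors an axiom read in the target. -/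
theorem evalHom_opBasis (h : IsTridendriformFamilyAlgebra precE succE dotE) (f : X → E) (n : ℕ) :
    ∀ (o : TriOp Ω) (T U : SchroderTree X Ω), sizeOf T + sizeOf U < n →
    evalHom precE succE dotE f (opBasis k o T U) =
      interpret precE succE dotE o (eval precE succE dotE f T) (eval precE succE dotE f U) := by
  -- The axioms with the summands in the order in which `opBasis` lists them.
  have hs (α β : Ω) (x y z : E) :
      succE (α * β) (succE α x y + precE β x y + dotE x y) z = succE α x (succE β y z) := by
    rw [← h.succ_succ, add_comm (succE α x y)]
  have hp (α β : Ω) (x y z : E) :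
      precE (α * β) x (succE α y z + precE β y z + dotE y z) = precE β (precE α x y) z := by
    rw [h.prec_prec, add_comm (succE α y z)]
  induction n with
  | zero => intros; omega
  | succ n ih =>
  rintro (ω | ω | _) T U hn
  · rcases T with ⟨b, x, _ | ⟨α, S⟩⟩ | ⟨b, x, T⟩
    · rw [opBasis, evalHom_basis, eval_pair_none, eval_pair_some, interpret,
        prec_branchAction h]
    · rw [opBasis, evalHom_mapDomain _ _ _ _ _
        (branchAction precE succE dotE f b ∘ₗ precE (α * ω) (f x))
        (fun R => eval_pair_some _ _ _ _ _ _ _ _), map_add (evalHom precE succE dotE f),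
        map_add (evalHom precE succE dotE f),
        ih _ _ _ (by simp at hn ⊢; omega), ih _ _ _ (by simp at hn ⊢; omega),
        ih _ _ _ (by simp at hn ⊢; omega), eval_pair_some]
      simp only [interpret, LinearMap.comp_apply, prec_branchAction h, hp]
    · rw [opBasis, evalHom_mapDomain _ _ _ _ _
        (branchAction precE succE dotE f b ∘ₗ dotE (f x))
        (fun R => eval_cons _ _ _ _ _ _ _), ih _ _ _ (by simp at hn ⊢; omega), eval_cons]
      simp only [interpret, LinearMap.comp_apply, prec_branchAction h, h.dot_prec]
  · rcases U with ⟨_ | ⟨β, V⟩, y, c⟩ | ⟨_ | ⟨β, V⟩, y, U⟩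
    · rw [opBasis, evalHom_basis, eval_some_pair, interpret]
    · rw [opBasis, evalHom_mapDomain _ _ _ _ _
        -- The recursive result sits on the first edge, hence in the left argument of `≻`; this is
        -- why the context is a flipped map.
        ((succE (ω * β)).flip (eval precE succE dotE f (pair none y c)))
        (fun R => eval_some_pair _ _ _ _ _ _ _ _), map_add (evalHom precE succE dotE f),
        map_add (evalHom precE succE dotE f),
        ih _ _ _ (by simp at hn ⊢; omega), ih _ _ _ (by simp at hn ⊢; omega),
        ih _ _ _ (by simp at hn ⊢; omega), eval_some_pair]
      simp only [interpret, LinearMap.flip_apply, hs]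
    · rw [opBasis, evalHom_basis, eval_some_cons, interpret]
    · rw [opBasis, evalHom_mapDomain _ _ _ _ _
        ((succE (ω * β)).flip (eval precE succE dotE f (cons none y U)))
        (fun R => eval_some_cons _ _ _ _ _ _ _ _), map_add (evalHom precE succE dotE f),
        map_add (evalHom precE succE dotE f),
        ih _ _ _ (by simp at hn ⊢; omega), ih _ _ _ (by simp at hn ⊢; omega),
        ih _ _ _ (by simp at hn ⊢; omega), eval_some_cons]
      simp only [interpret, LinearMap.flip_apply, hs]
  · rcases T with ⟨b, x, _ | ⟨α, S⟩⟩ | ⟨b, x, T⟩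
    · rw [opBasis, evalHom_basis, eval_pair_none, eval_cons, interpret, dot_branchAction h]
    · rcases U with ⟨_ | ⟨β, V⟩, y, c⟩ | ⟨_ | ⟨β, V⟩, y, U⟩
      -- Moving the edge `(α, S)` from the end of the left tree to the front of the right one is the
      -- axiom `(x ≺_α s) · u = x · (s ≻_α u)`.
      · rw [opBasis, evalHom_basis, eval_cons, eval_some_pair, eval_pair_some, interpret,
          dot_branchAction h, h.prec_dot]
      · rw [opBasis, evalHom_mapDomain _ _ _ _ _
          (branchAction precE succE dotE f b ∘ₗ dotE (f x) ∘ₗ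
            (succE (α * β)).flip (eval precE succE dotE f (pair none y c)))
          (fun R => by rw [eval_cons, eval_some_pair]; rfl), map_add (evalHom precE succE dotE f),
        map_add (evalHom precE succE dotE f),
          ih _ _ _ (by simp at hn ⊢; omega), ih _ _ _ (by simp at hn ⊢; omega),
          ih _ _ _ (by simp at hn ⊢; omega), eval_some_pair, eval_pair_some]
        simp only [interpret, LinearMap.comp_apply, LinearMap.flip_apply, hs,
          dot_branchAction h, h.prec_dot]
      · rw [opBasis, evalHom_basis, eval_cons, eval_some_cons, eval_pair_some, interpret,
          dot_branchAction h, h.prec_dot]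
      · rw [opBasis, evalHom_mapDomain _ _ _ _ _
          (branchAction precE succE dotE f b ∘ₗ dotE (f x) ∘ₗ
            (succE (α * β)).flip (eval precE succE dotE f (cons none y U)))
          (fun R => by rw [eval_cons, eval_some_cons]; rfl), map_add (evalHom precE succE dotE f),
        map_add (evalHom precE succE dotE f),
          ih _ _ _ (by simp at hn ⊢; omega), ih _ _ _ (by simp at hn ⊢; omega),
          ih _ _ _ (by simp at hn ⊢; omega), eval_some_cons, eval_pair_some]
        simp only [interpret, LinearMap.comp_apply, LinearMap.flip_apply, hs,
          dot_branchAction h, h.prec_dot]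
    · rw [opBasis, evalHom_mapDomain _ _ _ _ _
        (branchAction precE succE dotE f b ∘ₗ dotE (f x))
        (fun R => eval_cons _ _ _ _ _ _ _), ih _ _ _ (by simp at hn ⊢; omega), eval_cons]
      simp only [interpret, LinearMap.comp_apply, dot_branchAction h, h.dot_dot]

theorem evalHom_bilinearExtension (h : IsTridendriformFamilyAlgebra precE succE dotE)
    (f : X → E) (o : TriOp Ω) (a b : SchroderTree X Ω →₀ k) :
    evalHom precE succE dotE f (bilinearExtension (opBasis k o) a b) =
      interpret precE succE dotE o (evalHom precE succE dotE f a)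
        (evalHom precE succE dotE f b) := by
  induction a using finsupp_induction_basis with
  | zero => simp
  | add a b ha hb => simp [ha, hb]
  | smul r a ha => simp [ha]
  | basis T =>
  induction b using finsupp_induction_basis with
  | zero => simp
  | add a b ha hb => simp [ha, hb]
  | smul r a ha => simp [ha]
  | basis U =>
    rw [bilinearExtension_single, evalHom_basis, evalHom_basis]
    exact evalHom_opBasis h f _ o T U (Nat.lt_succ_self _)

theorem isTridendriformFamilyHom_evalHom (h : IsTridendriformFamilyAlgebra precE succE dotE)
    (f : X → E) :
    IsTridendriformFamilyHom (precOp k X) (succOp k X) (dotOp k X Ω) precE succE dotE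
      (evalHom precE succE dotE f) where
  map_prec ω := evalHom_bilinearExtension h f (prec ω)
  map_succ ω := evalHom_bilinearExtension h f (succ ω)
  map_dot := evalHom_bilinearExtension h f dot

theorem precOp_corolla (ω : Ω) (x : X) (T : SchroderTree X Ω) :
    precOp k X ω (Finsupp.single (corolla x) 1) (Finsupp.single T 1) =
      Finsupp.single (pair none x (some (ω, T))) 1 := by
  rw [precOp, bilinearExtension_single, corolla, opBasis]

theorem dotOp_corolla (x : X) (T : SchroderTree X Ω) :
    dotOp k X Ω (Finsupp.single (corolla x) 1) (Finsupp.single T 1) =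
      Finsupp.single (cons none x T) 1 := by
  rw [dotOp, bilinearExtension_single, corolla, opBasis]

theorem succOp_pair_none (ω : Ω) (S : SchroderTree X Ω) (x : X)
    (c : Option (Ω × SchroderTree X Ω)) :
    succOp k X ω (Finsupp.single S 1) (Finsupp.single (pair none x c) 1) =
      Finsupp.single (pair (some (ω, S)) x c) 1 := by
  rw [succOp, bilinearExtension_single, opBasis]

theorem succOp_cons_none (ω : Ω) (S : SchroderTree X Ω) (x : X) (T : SchroderTree X Ω) :
    succOp k X ω (Finsupp.single S 1) (Finsupp.single (cons none x T) 1) =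
      Finsupp.single (cons (some (ω, S)) x T) 1 := by
  rw [succOp, bilinearExtension_single, opBasis]

/-- The four preceding identities build every Schröder tree from corollas by the operations, in the
same pattern as `eval`. -/
theorem eq_evalHom (f : X → E) (F : (SchroderTree X Ω →₀ k) →ₗ[k] E)
    (hF : IsTridendriformFamilyHom (precOp k X) (succOp k X) (dotOp k X Ω) precE succE dotE F)
    (hf : ∀ x, F (Finsupp.single (corolla x) 1) = f x) :
    F = evalHom precE succE dotE f := by
  refine Finsupp.lhom_ext' fun T => LinearMap.ext_ring ?_
  simp only [LinearMap.comp_apply, Finsupp.lsingle_apply, evalHom_basis]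
  induction T using tree_induction with
  | pair_none_none x => rw [eval, ← hf, corolla]
  | pair_none_some x β S ih => rw [← precOp_corolla, hF.map_prec, ih, hf, eval]
  | pair_some_none α S x ih =>
    rw [← succOp_pair_none, hF.map_succ, ih, eval, ← hf, corolla]
  | pair_some_some α S x β S' ih ih' =>
    rw [← succOp_pair_none, hF.map_succ, ih, eval, ← precOp_corolla, hF.map_prec, ih', hf]
  | cons_none x T ih => rw [← dotOp_corolla, hF.map_dot, ih, hf, eval]
  | cons_some α S x T ih ih' =>
    rw [← succOp_cons_none, hF.map_succ, ih, eval, ← dotOp_corolla, hF.map_dot, ih', hf]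

end Hom

/-! ### The inclusion into planar trees: injectivity and image -/

section Inclusion

theorem toPlanar_pair (b c : Option (Ω × SchroderTree X Ω)) (x : X) :
    toPlanar (pair b x c) = .cons (b.map (Prod.map id toPlanar)) x
      (.single (c.map (Prod.map id toPlanar))) := by
  rcases b with _ | ⟨α, S⟩ <;> rcases c with _ | ⟨β, S'⟩ <;> simp [toPlanar]

theorem toPlanar_cons (b : Option (Ω × SchroderTree X Ω)) (x : X) (T : SchroderTree X Ω) :
    toPlanar (cons b x T) = .cons (b.map (Prod.map id toPlanar)) x (toPlanar T) := by
  rcases b with _ | ⟨α, S⟩ <;> simp [toPlanar]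

theorem toPlanar_injective : Function.Injective (toPlanar : SchroderTree X Ω → _) := by
  intro T
  induction T using tree_induction with
  | pair_none_none x =>
    rintro (⟨_ | ⟨β, V⟩, y, _ | ⟨γ, V'⟩⟩ | ⟨_ | ⟨β, V⟩, y, _ | _⟩) h <;>
      simp_all [toPlanar_pair, toPlanar_cons]
  | pair_none_some x β S ih =>
    rintro (⟨_ | ⟨β, V⟩, y, _ | ⟨γ, V'⟩⟩ | ⟨_ | ⟨β, V⟩, y, _ | _⟩) h <;>
      simp_all [toPlanar_pair, toPlanar_cons]
    exact ih rfl
  | pair_some_none α S x ih =>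
    rintro (⟨_ | ⟨β, V⟩, y, _ | ⟨γ, V'⟩⟩ | ⟨_ | ⟨β, V⟩, y, _ | _⟩) h <;>
      simp_all [toPlanar_pair, toPlanar_cons]
    exact ih rfl
  | pair_some_some α S x β S' ih ih' =>
    rintro (⟨_ | ⟨β, V⟩, y, _ | ⟨γ, V'⟩⟩ | ⟨_ | ⟨β, V⟩, y, _ | _⟩) h <;>
      simp_all [toPlanar_pair, toPlanar_cons]
    exact ⟨ih rfl, ih' rfl⟩
  | cons_none x T ih =>
    rintro (⟨_ | ⟨β, V⟩, y, c⟩ | ⟨_ | ⟨β, V⟩, y, U⟩) h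
    -- After its first edge a `pair` continues with a `single`, whereas `toPlanar T` always starts
    -- with a `cons`.
    · rcases T with _ | _ <;> simp_all [toPlanar_pair, toPlanar_cons]
    · simp_all [toPlanar_pair, toPlanar_cons]
    · simp only [toPlanar_cons, PlanarTree.cons.injEq] at h
      rw [h.2.1, ih h.2.2]
    · simp_all [toPlanar_cons]
  | cons_some α S x T ih ih' =>
    rintro (⟨_ | ⟨β, V⟩, y, c⟩ | ⟨_ | ⟨β, V⟩, y, U⟩) h
    · simp_all [toPlanar_pair, toPlanar_cons]
    · rcases T with _ | _ <;> simp_all [toPlanar_pair, toPlanar_cons]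
    · simp_all [toPlanar_cons]
    · simp only [toPlanar_cons, PlanarTree.cons.injEq, Option.map_some, Prod.map_apply, id,
        Option.some.injEq, Prod.mk.injEq] at h
      rw [h.2.1, ih' h.2.2, h.1.1, ih h.1.2]

theorem isSchroder_toPlanar (T : SchroderTree X Ω) : (toPlanar T).IsSchroder := by
  induction T using tree_induction with
  | pair_none_none x => rw [toPlanar]; exact .pair (by simp) (by simp)
  | pair_none_some x β S ih => rw [toPlanar]; exact .pair (by simp) (by simp [ih])
  | pair_some_none α S x ih => rw [toPlanar]; exact .pair (by simp [ih]) (by simp)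
  | pair_some_some α S x β S' ih ih' =>
    rw [toPlanar]; exact .pair (by simp [ih]) (by simp [ih'])
  | cons_none x T ih => rw [toPlanar]; exact .cons (by simp) ih
  | cons_some α S x T ih ih' => rw [toPlanar]; exact .cons (by simp [ih]) ih'

theorem exists_toPlanar_eq {T : PlanarTree X Ω} (hT : T.IsSchroder) :
    ∃ T' : SchroderTree X Ω, toPlanar T' = T := by
  have branch {b : Option (Ω × PlanarTree X Ω)}
      (hb : ∀ ω S, b = some (ω, S) → ∃ S' : SchroderTree X Ω, toPlanar S' = S) :
      ∃ b' : Option (Ω × SchroderTree X Ω), b'.map (Prod.map id toPlanar) = b := by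
    rcases b with _ | ⟨α, S⟩
    · exact ⟨none, rfl⟩
    · obtain ⟨S', rfl⟩ := hb α S rfl
      exact ⟨some (α, S'), rfl⟩
  induction hT with
  | pair _ _ hb hc =>
    obtain ⟨b, rfl⟩ := branch hb
    obtain ⟨c, rfl⟩ := branch hc
    exact ⟨pair b _ c, toPlanar_pair _ _ _⟩
  | cons _ _ hb hT =>
    obtain ⟨b, rfl⟩ := branch hb
    obtain ⟨T, rfl⟩ := hT
    exact ⟨cons b _ T, toPlanar_cons _ _ _⟩

theorem rescaledInclusion_basis (c : k) (T : SchroderTree X Ω) :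
    rescaledInclusion k X Ω c (Finsupp.single T 1) =
      c ^ numVertices T • Finsupp.single (toPlanar T) 1 := by
  simp [rescaledInclusion]

theorem rescaledInclusion_one : rescaledInclusion k X Ω 1 = inclusion k X Ω := by
  refine Finsupp.lhom_ext' fun T => LinearMap.ext_ring ?_
  simp [rescaledInclusion, inclusion, Finsupp.mapDomain_single]

/-- The map is diagonal on the tree bases, so a unit `c` can be cancelled coefficientwise. -/
theorem rescaledInclusion_apply (c : k) (a : SchroderTree X Ω →₀ k) (T : SchroderTree X Ω) :
    rescaledInclusion k X Ω c a (toPlanar T) = c ^ numVertices T * a T := by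
  classical
  induction a using finsupp_induction_basis with
  | zero => simp
  | add a b ha hb => simp [ha, hb, mul_add]
  | smul r a ha => simp [ha, mul_left_comm]
  | basis S =>
    rw [rescaledInclusion_basis, Finsupp.smul_apply, Finsupp.single_apply, Finsupp.single_apply,
      toPlanar_injective.eq_iff]
    split_ifs with h <;> simp [h]

theorem rescaledInclusion_injective (c : kˣ) :
    Function.Injective (rescaledInclusion k X Ω (c : k)) := by
  intro a b h
  ext T
  have := DFunLike.congr_fun h (toPlanar T)
  rw [rescaledInclusion_apply, rescaledInclusion_apply] at this
  exact (c.isUnit.pow _).mul_left_cancel this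

theorem range_rescaledInclusion (c : kˣ) :
    LinearMap.range (rescaledInclusion k X Ω (c : k)) = PlanarTree.schroderSpan k X Ω := by
  rw [PlanarTree.schroderSpan, Finsupp.supported_eq_span_single]
  apply le_antisymm
  · rintro _ ⟨a, rfl⟩
    induction a using finsupp_induction_basis with
    | zero => simp
    | add a b ha hb => rw [map_add]; exact add_mem ha hb
    | smul r a ha => rw [map_smul]; exact Submodule.smul_mem _ _ ha
    | basis T =>
      rw [rescaledInclusion_basis]
      exact Submodule.smul_mem _ _ (Submodule.subset_span ⟨_, isSchroder_toPlanar T, rfl⟩)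
  · rw [Submodule.span_le]
    rintro _ ⟨T, hT, rfl⟩
    obtain ⟨T, rfl⟩ := exists_toPlanar_eq hT
    refine ⟨((c⁻¹ : kˣ) : k) ^ numVertices T • Finsupp.single T 1, ?_⟩
    rw [map_smul, rescaledInclusion_basis, smul_smul, ← mul_pow, Units.inv_mul, one_pow,
      one_smul]

end Inclusion

/-! ### The rescaled inclusion as an evaluation -/

section Embedding

open PlanarTree (diamond graftOp)

variable [Semigroup Ω] (l : kˣ)

/-- The rescaled inclusion is the morphism induced by `x ↦ l⁻¹ Y_x`. -/
theorem rescaledInclusion_eq_evalHom :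
    rescaledInclusion k X Ω ((l⁻¹ : kˣ) : k) =
      evalHom (inducedPrec (diamond k X Ω (l : k)) (graftOp k X))
        (inducedSucc (diamond k X Ω (l : k)) (graftOp k X)) ((l : k) • diamond k X Ω (l : k))
        (fun x => ((l⁻¹ : kˣ) : k) • Finsupp.single (PlanarTree.corolla x) 1) := by
  have hl : (l : k) * ((l⁻¹ : kˣ) : k) = 1 := Units.mul_inv l
  refine Finsupp.lhom_ext' fun T => LinearMap.ext_ring ?_
  simp only [LinearMap.comp_apply, Finsupp.lsingle_apply, evalHom_basis,
    rescaledInclusion_basis]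
  induction T using tree_induction with
  | pair_none_none x => simp [eval, numVertices, toPlanar, PlanarTree.corolla]
  | pair_none_some x β S ih =>
    rw [eval, ← ih, numVertices, toPlanar, PlanarTree.cons_eq_appendOp,
      PlanarTree.single_some_eq_graftOp, PlanarTree.single_none_eq_unit]
    simp only [inducedPrec, LinearMap.compl₂_apply, map_smul, LinearMap.smul_apply,
      PlanarTree.corolla_diamond, smul_smul, pow_add, pow_one, mul_comm]
  | pair_some_none α S x ih =>
    rw [eval, ← ih, numVertices, toPlanar, PlanarTree.cons_eq_appendOp,
      PlanarTree.single_some_eq_graftOp, PlanarTree.single_none_eq_unit,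
      PlanarTree.appendOp_eq_diamond (l : k), PlanarTree.diamond_unit]
    simp only [inducedSucc, LinearMap.comp_apply, map_smul, LinearMap.smul_apply,
      smul_smul, pow_add, pow_one]
  | pair_some_some α S x β S' ih ih' =>
    rw [eval, ← ih, ← ih', numVertices, toPlanar, PlanarTree.cons_eq_appendOp,
      PlanarTree.single_some_eq_graftOp, PlanarTree.single_some_eq_graftOp,
      PlanarTree.appendOp_eq_diamond (l : k)]
    simp only [inducedPrec, inducedSucc, LinearMap.compl₂_apply, LinearMap.comp_apply, map_smul,
      LinearMap.smul_apply, smul_smul, pow_add, pow_one]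
    congr 1
    ring
  | cons_none x T ih =>
    rw [eval, ← ih, numVertices, toPlanar, PlanarTree.cons_eq_appendOp,
      PlanarTree.single_none_eq_unit]
    simp only [LinearMap.smul_apply, map_smul, PlanarTree.corolla_diamond, smul_smul]
    congr 1
    -- Identifying two roots loses one vertex, so one factor `l⁻¹` is in excess; the `l` in `l • ⋄`
    -- absorbs it.
    linear_combination -((l⁻¹ : kˣ) : k) ^ numVertices T * hl
  | cons_some α S x T ih ih' =>
    rw [eval, ← ih, ← ih', numVertices, toPlanar, PlanarTree.cons_eq_appendOp,
      PlanarTree.single_some_eq_graftOp, PlanarTree.appendOp_eq_diamond (l : k)]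
    simp only [inducedSucc, LinearMap.comp_apply, map_smul, LinearMap.smul_apply, smul_smul,
      pow_add]
    congr 1
    linear_combination
      -((l⁻¹ : kˣ) : k) ^ numVertices S * ((l⁻¹ : kˣ) : k) ^ numVertices T * hl

theorem isTridendriformFamilyHom_rescaledInclusion :
    IsTridendriformFamilyHom (precOp k X) (succOp k X) (dotOp k X Ω)
      (inducedPrec (diamond k X Ω (l : k)) (graftOp k X))
      (inducedSucc (diamond k X Ω (l : k)) (graftOp k X)) ((l : k) • diamond k X Ω (l : k))
      (rescaledInclusion k X Ω ((l⁻¹ : kˣ) : k)) := by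
  rw [rescaledInclusion_eq_evalHom]
  exact isTridendriformFamilyHom_evalHom
    (PlanarTree.isRotaBaxterFamilyAlgebra_diamond (l : k)).isTridendriformFamilyAlgebra _

end Embedding

end SchroderTree

/-! ### Transfer along morphisms and the theorem -/

/-- The image of a morphism of tridendriform family algebras is a subalgebra. -/
theorem IsTridendriformFamilyHom.isTridendriformFamilySubalgebra_range
    {k : Type*} [CommRing k] {Ω : Type*} {D E : Type*} [AddCommGroup D] [Module k D]
    [AddCommGroup E] [Module k E] {precD succD : Ω → D →ₗ[k] D →ₗ[k] D}
    {dotD : D →ₗ[k] D →ₗ[k] D} {precE succE : Ω → E →ₗ[k] E →ₗ[k] E}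
    {dotE : E →ₗ[k] E →ₗ[k] E} {F : D →ₗ[k] E}
    (h : IsTridendriformFamilyHom precD succD dotD precE succE dotE F) :
    IsTridendriformFamilySubalgebra precE succE dotE (LinearMap.range F) where
  prec_mem := by
    rintro ω _ ⟨a, rfl⟩ _ ⟨b, rfl⟩
    exact ⟨_, h.map_prec ω a b⟩
  succ_mem := by
    rintro ω _ ⟨a, rfl⟩ _ ⟨b, rfl⟩
    exact ⟨_, h.map_succ ω a b⟩
  dot_mem := by
    rintro _ ⟨a, rfl⟩ _ ⟨b, rfl⟩
    exact ⟨_, h.map_dot a b⟩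

/-- The axioms of a tridendriform family algebra can be checked after an injective map that
respects the operations. -/
theorem IsTridendriformFamilyAlgebra.of_injective
    {k : Type*} [CommRing k] {Ω : Type*} [Semigroup Ω] {D E : Type*} [AddCommGroup D]
    [Module k D] [AddCommGroup E] [Module k E] {precD succD : Ω → D →ₗ[k] D →ₗ[k] D}
    {dotD : D →ₗ[k] D →ₗ[k] D} {precE succE : Ω → E →ₗ[k] E →ₗ[k] E}
    {dotE : E →ₗ[k] E →ₗ[k] E} {F : D →ₗ[k] E}
    (hE : IsTridendriformFamilyAlgebra precE succE dotE)
    (h : IsTridendriformFamilyHom precD succD dotD precE succE dotE F)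
    (hF : Function.Injective F) : IsTridendriformFamilyAlgebra precD succD dotD where
  prec_prec α β x y z := hF <| by
    simp only [h.map_prec, h.map_succ, h.map_dot, map_add F, hE.prec_prec]
  succ_prec α β x y z := hF <| by simp only [h.map_prec, h.map_succ, hE.succ_prec]
  succ_succ α β x y z := hF <| by
    simp only [h.map_prec, h.map_succ, h.map_dot, map_add F, hE.succ_succ]
  succ_dot α x y z := hF <| by simp only [h.map_dot, h.map_succ, hE.succ_dot]
  prec_dot α x y z := hF <| by simp only [h.map_dot, h.map_succ, h.map_prec, hE.prec_dot]
  dot_prec α x y z := hF <| by simp only [h.map_dot, h.map_prec, hE.dot_prec]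
  dot_dot x y z := hF <| by simp only [h.map_dot, hE.dot_dot]

theorem SchroderTree.isFreeTridendriformFamilyAlgebra (k X Ω : Type*) [CommRing k]
    [Semigroup Ω] :
    IsFreeTridendriformFamilyAlgebra.{w} (SchroderTree.precOp k X (Ω := Ω))
      (SchroderTree.succOp k X) (SchroderTree.dotOp k X Ω)
      (fun x : X => Finsupp.single (SchroderTree.corolla x) 1) := by
  -- The axioms are pulled back from the planar trees along the embedding of weight 1.
  refine ⟨IsTridendriformFamilyAlgebra.of_injective
    (PlanarTree.isRotaBaxterFamilyAlgebra_diamond _).isTridendriformFamilyAlgebra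
    (isTridendriformFamilyHom_rescaledInclusion (1 : kˣ)) (rescaledInclusion_injective _), ?_⟩
  intro E _ _ precE succE dotE h f
  refine ⟨evalHom precE succE dotE f,
    ⟨isTridendriformFamilyHom_evalHom h f, fun x => ?_⟩, fun F hF => eq_evalHom f F hF.1 hF.2⟩
  rw [evalHom_basis, corolla, eval]

theorem theorem3p8 (k X Ω : Type*) [CommRing k] [Semigroup Ω] :
    -- the trees form the free Rota-Baxter family algebra of weight 1
    IsFreeRotaBaxterFamilyAlgebra.{w} (1 : k) (PlanarTree.diamond k X Ω 1)
      (Finsupp.single PlanarTree.unit 1) (PlanarTree.graftOp k X)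
      (fun x : X => Finsupp.single (PlanarTree.corolla x) 1) ∧
    -- the Schröder trees form the free tridendriform family algebra
    IsFreeTridendriformFamilyAlgebra.{w} (SchroderTree.precOp k X (Ω := Ω))
      (SchroderTree.succOp k X) (SchroderTree.dotOp k X Ω)
      (fun x : X => Finsupp.single (SchroderTree.corolla x) 1) ∧
    -- the induced operations of weight 1 on the span of all trees
    IsTridendriformFamilyAlgebra
      (inducedPrec (PlanarTree.diamond k X Ω 1) (PlanarTree.graftOp k X))
      (inducedSucc (PlanarTree.diamond k X Ω 1) (PlanarTree.graftOp k X))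
      (PlanarTree.diamond k X Ω 1) ∧
    -- the span of the Schröder trees is a subalgebra for the induced operations ...
    IsTridendriformFamilySubalgebra
      (inducedPrec (PlanarTree.diamond k X Ω 1) (PlanarTree.graftOp k X))
      (inducedSucc (PlanarTree.diamond k X Ω 1) (PlanarTree.graftOp k X))
      (PlanarTree.diamond k X Ω 1) (PlanarTree.schroderSpan k X Ω) ∧
    -- ... and the canonical inclusion identifies the free tridendriform family algebra with it
    IsTridendriformFamilyHom
      (SchroderTree.precOp k X) (SchroderTree.succOp k X) (SchroderTree.dotOp k X Ω)
      (inducedPrec (PlanarTree.diamond k X Ω 1) (PlanarTree.graftOp k X))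
      (inducedSucc (PlanarTree.diamond k X Ω 1) (PlanarTree.graftOp k X))
      (PlanarTree.diamond k X Ω 1) (SchroderTree.inclusion k X Ω) ∧
    Function.Injective (SchroderTree.inclusion k X Ω) ∧
    LinearMap.range (SchroderTree.inclusion k X Ω) = PlanarTree.schroderSpan k X Ω ∧
    (∀ x : X, SchroderTree.inclusion k X Ω (Finsupp.single (SchroderTree.corolla x) 1) =
      Finsupp.single (PlanarTree.corolla x) 1) ∧
    -- the same for every invertible weight `l`, with the inclusion rescaled
    ∀ l : kˣ,
      IsFreeRotaBaxterFamilyAlgebra.{w} (l : k) (PlanarTree.diamond k X Ω l)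
        (Finsupp.single PlanarTree.unit 1) (PlanarTree.graftOp k X)
        (fun x : X => Finsupp.single (PlanarTree.corolla x) 1) ∧
      IsTridendriformFamilyAlgebra
        (inducedPrec (PlanarTree.diamond k X Ω l) (PlanarTree.graftOp k X))
        (inducedSucc (PlanarTree.diamond k X Ω l) (PlanarTree.graftOp k X))
        ((l : k) • PlanarTree.diamond k X Ω l) ∧
      IsTridendriformFamilySubalgebra
        (inducedPrec (PlanarTree.diamond k X Ω l) (PlanarTree.graftOp k X))
        (inducedSucc (PlanarTree.diamond k X Ω l) (PlanarTree.graftOp k X))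
        ((l : k) • PlanarTree.diamond k X Ω l) (PlanarTree.schroderSpan k X Ω) ∧
      IsTridendriformFamilyHom
        (SchroderTree.precOp k X) (SchroderTree.succOp k X) (SchroderTree.dotOp k X Ω)
        (inducedPrec (PlanarTree.diamond k X Ω l) (PlanarTree.graftOp k X))
        (inducedSucc (PlanarTree.diamond k X Ω l) (PlanarTree.graftOp k X))
        ((l : k) • PlanarTree.diamond k X Ω l)
        (SchroderTree.rescaledInclusion k X Ω ((l⁻¹ : kˣ) : k)) ∧
      Function.Injective (SchroderTree.rescaledInclusion k X Ω ((l⁻¹ : kˣ) : k)) ∧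
      LinearMap.range (SchroderTree.rescaledInclusion k X Ω ((l⁻¹ : kˣ) : k)) =
        PlanarTree.schroderSpan k X Ω ∧
      ∀ x : X, SchroderTree.rescaledInclusion k X Ω ((l⁻¹ : kˣ) : k)
          (Finsupp.single (SchroderTree.corolla x) 1) =
        ((l⁻¹ : kˣ) : k) • SchroderTree.inclusion k X Ω
          (Finsupp.single (SchroderTree.corolla x) 1) := by
  have h1 := SchroderTree.isTridendriformFamilyHom_rescaledInclusion (X := X) (Ω := Ω) (1 : kˣ)
  have hinj := SchroderTree.rescaledInclusion_injective (X := X) (Ω := Ω) (1 : kˣ)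
  have hrange := SchroderTree.range_rescaledInclusion (X := X) (Ω := Ω) (1 : kˣ)
  have htri := (PlanarTree.isRotaBaxterFamilyAlgebra_diamond (X := X) (Ω := Ω)
    (1 : k)).isTridendriformFamilyAlgebra
  -- Weight 1 is the case `l = 1`: the vertex factors become 1 and `1 • ⋄` becomes `⋄`.
  rw [inv_one] at h1
  rw [Units.val_one, SchroderTree.rescaledInclusion_one] at h1 hinj hrange
  rw [one_smul] at h1 htri
  refine ⟨PlanarTree.isFreeRotaBaxterFamilyAlgebra_diamond 1,
    SchroderTree.isFreeTridendriformFamilyAlgebra k X Ω, htri,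
    hrange ▸ h1.isTridendriformFamilySubalgebra_range, h1, hinj, hrange, fun x => ?_, fun l => ?_⟩
  · simp [SchroderTree.inclusion, Finsupp.mapDomain_single, SchroderTree.corolla,
      SchroderTree.toPlanar, PlanarTree.corolla]
  · have hl := SchroderTree.isTridendriformFamilyHom_rescaledInclusion (X := X) (Ω := Ω) l
    refine ⟨PlanarTree.isFreeRotaBaxterFamilyAlgebra_diamond _,
      (PlanarTree.isRotaBaxterFamilyAlgebra_diamond _).isTridendriformFamilyAlgebra,
      -- Closure of the Schröder span is read off from its being the image of a morphism.
      SchroderTree.range_rescaledInclusion (X := X) (Ω := Ω) l⁻¹ ▸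
        hl.isTridendriformFamilySubalgebra_range, hl,
      SchroderTree.rescaledInclusion_injective _, SchroderTree.range_rescaledInclusion _,
      fun x => ?_⟩
    rw [← SchroderTree.rescaledInclusion_one, SchroderTree.rescaledInclusion_basis,
      SchroderTree.rescaledInclusion_basis, SchroderTree.corolla, SchroderTree.numVertices,
      pow_one, pow_one, one_smul]
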